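/- Let $X$ be a sequentially complete Hausdorff locally convex space over $\mathbb{C}$ such that its strong dual $X'_b$ (the topological dual $X'$ with the topology of uniform convergence on bounded subsets of $X$) is sequentially complete. Let $(T(t))_{t\ge0}$ be a strongly continuous, locally equicontinuous semigroup of continuous linear operators on $X$; here local equicontinuity means that for every continuous seminorm $q$ on $X$ and every $t_0\ge0$ there are a continuous seminorm $p$ on $X$ and $C\ge0$ with $q(T(t)x)\le C\,p(x)$ for all $t\in[0,t_0]$ and $x\in X$. Let $(A,D(A))$ be its generator, i.e. $Ax=\lim_{t\to0+}\frac{T(t)x-x}{t}$ on the domain $D(A)$ of all $x\in X$ for which this limit exists in $X$. For a linear operator $(B,D(B))$ on $X$ put \[ \rho_{\mathrm{alg}}(B)=\{\lambda\in\mathbb{C} : \lambda-B\colon D(B)\to X \text{ is bijective}\},\qquad \sigma_{\mathrm{r}}(B)=\{\lambda\in\mathbb{C} : (\lambda-B)D(B) \text{ is not dense in } X\}. \] Assume that $\rho_{\mathrm{alg}}(A)\neq\varnothing$. Then \[ \sigma_{\mathrm{r}}(T(t))\setminus\{0\}=\mathrm{e}^{t\sigma_{\mathrm{r}}(A)}=\{\mathrm{e}^{t\mu}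 : \mu\in\sigma_{\mathrm{r}}(A)\} \] for all $t>0$, and also for $t=0$ provided that $\sigma_{\mathrm{r}}(A)\neq\varnothing$ or $X=\{0\}$. -/

import Mathlib

open Filter Topology
open scoped NNReal

namespace LCSemigroup

noncomputable section

/-- Every Cauchy sequence converges. -/
def SeqCompleteSpace (Y : Type*) [UniformSpace Y] : Prop :=
  ∀ u : ℕ → Y, CauchySeq u → ∃ y : Y, Tendsto u atTop (𝓝 y)

section Spectra

variable {X : Type*} [AddCommGroup X] [Module ℂ X]

/-- The operator `z - A : D(A) → X` for a linear operator `(A, D(A))` on `X`. -/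
def shift (A : X →ₗ.[ℂ] X) (z : ℂ) : A.domain →ₗ[ℂ] X :=
  z • A.domain.subtype - A.toFun

/-- The algebraic resolvent set: all `z` such that `z - A : D(A) → X` is bijective. -/
def algResolventSet (A : X →ₗ.[ℂ] X) : Set ℂ :=
  {z | Function.Bijective (shift A z)}

/-- The residual spectrum: all `z` such that the range of `z - A` is not dense in `X`. -/
def residualSpectrum [TopologicalSpace X] (A : X →ₗ.[ℂ] X) : Set ℂ :=
  {z | ¬ Dense (Set.range (shift A z))}

/-- An everywhere defined continuous linear operator, as an operator with domain `X`. -/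
def toOperator [TopologicalSpace X] (S : X →L[ℂ] X) : X →ₗ.[ℂ] X :=
  (S : X →ₗ[ℂ] X).toPMap ⊤

end Spectra

section Semigroups

variable {X : Type*} [AddCommGroup X] [Module ℂ X] [TopologicalSpace X]

/-- `(T(t))_{t ≥ 0}` is a (one-parameter) semigroup of continuous linear operators. -/
structure IsSemigroup (T : ℝ≥0 → X →L[ℂ] X) : Prop where
  zero : T 0 = ContinuousLinearMap.id ℂ X
  add : ∀ t s : ℝ≥0, T (t + s) = (T t).comp (T s)

/-- `t ↦ T(t)` is continuous for the topology of pointwise convergence. -/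
def StronglyContinuous (T : ℝ≥0 → X →L[ℂ] X) : Prop :=
  ∀ x : X, Continuous fun t : ℝ≥0 => T t x

/-- Local equicontinuity, with the system of all continuous seminorms as fundamental system. -/
def LocallyEquicontinuous (T : ℝ≥0 → X →L[ℂ] X) : Prop :=
  ∀ q : Seminorm ℂ X, Continuous q → ∀ t₀ : ℝ≥0,
    ∃ p : Seminorm ℂ X, Continuous p ∧ ∃ C : ℝ, 0 ≤ C ∧
      ∀ t : ℝ≥0, t ≤ t₀ → ∀ x : X, q (T t x) ≤ C * p x

/-- `y = lim_{t → 0+} (T(t) x - x) / t`. -/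
def HasRightDeriv (T : ℝ≥0 → X →L[ℂ] X) (x y : X) : Prop :=
  Tendsto (fun t : ℝ≥0 => ((t : ℝ) : ℂ)⁻¹ • (T t x - x)) (𝓝[>] 0) (𝓝 y)

theorem HasRightDeriv.add [IsTopologicalAddGroup X] {T : ℝ≥0 → X →L[ℂ] X} {x x' y y' : X}
    (h : HasRightDeriv T x y) (h' : HasRightDeriv T x' y') :
    HasRightDeriv T (x + x') (y + y') := by
  refine (Tendsto.add h h').congr fun t => ?_
  rw [← smul_add, map_add]
  congr 1
  abel

theorem HasRightDeriv.smul [ContinuousSMul ℂ X] {T : ℝ≥0 → X →L[ℂ] X} {x y : X} (c : ℂ)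
    (h : HasRightDeriv T x y) : HasRightDeriv T (c • x) (c • y) := by
  refine (Tendsto.const_smul h c).congr fun t => ?_
  rw [map_smul, ← smul_sub, smul_comm]

theorem HasRightDeriv.zero (T : ℝ≥0 → X →L[ℂ] X) : HasRightDeriv T 0 0 := by
  simpa [HasRightDeriv] using tendsto_const_nhds

theorem HasRightDeriv.unique [T2Space X] {T : ℝ≥0 → X →L[ℂ] X} {x y y' : X}
    (h : HasRightDeriv T x y) (h' : HasRightDeriv T x y') : y = y' :=
  tendsto_nhds_unique h h'

/-- The generator `(A, D(A))` of `(T(t))_{t ≥ 0}`: its domain consists of all `x` for which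
`lim_{t → 0+} (T(t) x - x) / t` exists in `X`, and `A x` is this limit. -/
def generator [IsTopologicalAddGroup X] [ContinuousSMul ℂ X] [T2Space X]
    (T : ℝ≥0 → X →L[ℂ] X) : X →ₗ.[ℂ] X where
  domain :=
    { carrier := {x | ∃ y, HasRightDeriv T x y}
      add_mem' := fun ⟨y, hy⟩ ⟨y', hy'⟩ => ⟨y + y', hy.add hy'⟩
      zero_mem' := ⟨0, HasRightDeriv.zero T⟩
      smul_mem' := fun c _ ⟨y, hy⟩ => ⟨c • y, hy.smul c⟩ }
  toFun :=
    { toFun := fun x => Classical.choose x.2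
      map_add' := fun x x' => (Classical.choose_spec (x + x').2).unique
        ((Classical.choose_spec x.2).add (Classical.choose_spec x'.2))
      map_smul' := fun c x => (Classical.choose_spec (c • x).2).unique
        ((Classical.choose_spec x.2).smul c) }

variable [IsTopologicalAddGroup X] [ContinuousSMul ℂ X]

theorem mem_generator_domain [T2Space X] (T : ℝ≥0 → X →L[ℂ] X) (x : X) :
    x ∈ (generator T).domain ↔ ∃ y, HasRightDeriv T x y :=
  Iff.rfl

theorem hasRightDeriv_generator [T2Space X] (T : ℝ≥0 → X →L[ℂ] X) (x : (generator T).domain) :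
    HasRightDeriv T x (generator T x) :=
  Classical.choose_spec x.2

end Semigroups

end

end LCSemigroup

/-! By Hahn–Banach, `z` lies in the residual spectrum of an operator iff some nonzero continuous
functional `φ` satisfies `φ ∘ A = z φ` on the domain, so the claim is about eigenfunctionals
(`mem_residualSpectrum_iff`).

From `A` to `T(t)`: sequential completeness provides `∫₀ˢ T(r)x dr` as a limit of Riemann sums. It
lies in `D(A)` and `A` sends it to `T(s)x - x`, hence `φ(T(s)x) - φ(x) = z ∫₀ˢ φ(T(r)x) dr`. This
scalar equation forces `φ ∘ T(t) = e^{tz} φ` (`functional_apply_of_generator`).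

From `T(t)` to `A`, with `t > 0`: let `φ ∘ T(t) = w φ`, `w ≠ 0`. For each solution `z` of `e^{tz} =
w` the functional `ψ(x) = ∫₀ᵗ e^{-sz} φ(T(s)x) ds` is continuous by local equicontinuity and
satisfies `ψ ∘ A = z ψ`. If `ψ` vanished for all these `z`, then for each `x` all Fourier
coefficients of `s ↦ e^{-s log(w)/t} φ(T(s)x)` would vanish, so `φ = 0`
(`exists_eigenfunctional_generator`). -/

namespace LCSemigroup

/-! ### Hahn–Banach, eigenfunctionals and continuous seminorms -/

section HahnBanach

variable {X : Type*} [AddCommGroup X] [Module ℂ X] [TopologicalSpace X]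
  [IsTopologicalAddGroup X] [ContinuousSMul ℂ X] [LocallyConvexSpace ℝ X]

/-- A subspace fails to be dense iff some nonzero continuous functional annihilates it. -/
theorem not_dense_iff_exists_functional (M : Submodule ℂ X) :
    ¬ Dense (M : Set X) ↔ ∃ φ : X →L[ℂ] ℂ, φ ≠ 0 ∧ ∀ m ∈ M, φ m = 0 := by
  constructor
  · intro h
    obtain ⟨x, hx⟩ : ∃ x, x ∉ closure (M : Set X) := by
      simpa [Dense] using h
    have hconv : Convex ℝ (closure (M : Set X)) := by
      have := IsScalarTower.continuousSMul (M := ℝ) (α := X) ℂ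
      exact (M.restrictScalars ℝ).convex.closure
    obtain ⟨φ, u, hu, hux⟩ :=
      RCLike.geometric_hahn_banach_closed_point (𝕜 := ℂ) hconv isClosed_closure hx
    have hu' : ∀ m ∈ M, (φ m).re < u := fun m hm => hu m (subset_closure hm)
    have hu0 : 0 < u := by simpa using hu' 0 M.zero_mem
    refine ⟨φ, ?_, fun m hm => ?_⟩
    · rintro rfl
      have h0 : u < (0 : ℝ) := by simpa using hux
      exact lt_asymm hu0 h0
    · by_contra hne
      -- A real part bounded above on a subspace forces `φ = 0` there: this multiple of `m` has
      -- `φ`-value exactly `u`, which the strict bound excludes.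
      have h1 := hu' (((u : ℂ) * (φ m)⁻¹) • m) (M.smul_mem _ hm)
      rw [map_smul, smul_eq_mul, mul_assoc, inv_mul_cancel₀ hne, mul_one,
        Complex.ofReal_re] at h1
      exact lt_irrefl _ h1
  · rintro ⟨φ, hφ, hM⟩ hd
    apply hφ
    refine ContinuousLinearMap.ext fun x => ?_
    exact congrFun (Continuous.ext_on hd φ.continuous continuous_zero fun m hm => hM m hm) x

theorem eq_of_forall_functional_eq [T2Space X] {x y : X} (h : ∀ φ : X →L[ℂ] ℂ, φ x = φ y) :
    x = y := by
  by_contra hne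
  obtain ⟨φ, hφ⟩ := RCLike.geometric_hahn_banach_point_point (𝕜 := ℂ) hne
  rw [h φ] at hφ
  exact lt_irrefl _ hφ

theorem mem_residualSpectrum_iff (A : X →ₗ.[ℂ] X) (z : ℂ) :
    z ∈ residualSpectrum A ↔
      ∃ φ : X →L[ℂ] ℂ, φ ≠ 0 ∧ ∀ x : A.domain, φ (A x) = z * φ x := by
  have h := not_dense_iff_exists_functional (LinearMap.range (shift A z))
  rw [LinearMap.coe_range] at h
  refine h.trans (exists_congr fun φ => and_congr_right fun _ => ?_)
  simp only [LinearMap.mem_range, forall_exists_index, forall_apply_eq_imp_iff]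
  refine forall_congr' fun x => ?_
  have : shift A z x = z • (x : X) - A x := rfl
  rw [this, map_sub, map_smul, smul_eq_mul, sub_eq_zero, eq_comm]

theorem mem_residualSpectrum_toOperator_iff (S : X →L[ℂ] X) (z : ℂ) :
    z ∈ residualSpectrum (toOperator S) ↔
      ∃ φ : X →L[ℂ] ℂ, φ ≠ 0 ∧ ∀ x : X, φ (S x) = z * φ x := by
  rw [mem_residualSpectrum_iff]
  refine exists_congr fun φ => and_congr_right fun _ =>
    ⟨fun h x => h ⟨x, Submodule.mem_top⟩, fun h x => h x⟩

-- The seminorm is the gauge of an open absolutely convex set inside `U`. Real convexity transfers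
-- to `ℂ` because nonnegative elements of `ℂ` are real.
open scoped ComplexOrder in
theorem exists_continuous_seminorm_ball_subset {U : Set X} (hU : U ∈ 𝓝 (0 : X)) :
    ∃ q : Seminorm ℂ X, Continuous q ∧ ∀ x, q x < 1 → x ∈ U := by
  have := IsScalarTower.continuousSMul (M := ℝ) (α := X) ℂ
  have : LocallyConvexSpace ℂ X := by
    refine (locallyConvexSpace_iff_exists_convex_subset_zero ℂ X).2 fun V hV => ?_
    obtain ⟨S, hS, hc, hSV⟩ := (locallyConvexSpace_iff_exists_convex_subset_zero ℝ X).1 ‹_› V hV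
    exact ⟨S, hS, convex_of_nonneg_surjective_algebraMap _
      (fun _ hz => RCLike.nonneg_iff_exists_ofReal.mp hz) hc, hSV⟩
  obtain ⟨s, hs, hsU⟩ := (nhds_hasBasis_absConvex_open ℂ X).mem_iff.1 hU
  refine ⟨gaugeSeminormFamily ℂ X ⟨s, hs⟩, with_gaugeSeminormFamily.continuous_seminorm _,
    fun x hx => hsU ?_⟩
  have h := gaugeSeminormFamily_ball (𝕜 := ℂ) (E := X) ⟨s, hs⟩
  rw [← Seminorm.mem_ball_zero, h] at hx
  exact hx

theorem tendsto_of_forall_seminorm {α : Type*} {l : Filter α} {u : α → X} {y : X}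
    (h : ∀ q : Seminorm ℂ X, Continuous q → ∀ ε > 0, ∀ᶠ a in l, q (u a - y) ≤ ε) :
    Tendsto u l (𝓝 y) := by
  rw [← tendsto_sub_nhds_zero_iff]
  refine tendsto_def.2 fun U hU => ?_
  obtain ⟨q, hq, hqU⟩ := exists_continuous_seminorm_ball_subset hU
  filter_upwards [h q hq (1 / 2) (by norm_num)] with a ha
  exact hqU (u a - y) (ha.trans_lt (by norm_num))

end HahnBanach
-- Riemann sums and integrals in sequentially complete spaces
theorem sum_range_mul_eq {Y : Type*} [AddCommMonoid Y] (F : ℕ → Y) (N M : ℕ) :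
    ∑ j ∈ Finset.range (N * M), F j =
      ∑ k ∈ Finset.range N, ∑ i ∈ Finset.range M, F (k * M + i) := by
  induction N with
  | zero => simp
  | succ N ih => rw [Nat.succ_mul, Finset.sum_range_add, ih, Finset.sum_range_succ]

section Riemann

variable {X : Type*} [AddCommGroup X] [Module ℂ X]

/-- The left Riemann sum of `f` on `[0, h]` for the partition into `N` equal pieces. -/
noncomputable def riemannSum (f : ℝ → X) (h : ℝ) (N : ℕ) : X :=
  ∑ k ∈ Finset.range N, ((h / N : ℝ) : ℂ) • f (h * k / N)

theorem seminorm_sum_smul_le (q : Seminorm ℂ X) {c ε : ℝ} (hc : 0 ≤ c) (N : ℕ) (g : ℕ → X)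
    (hg : ∀ k < N, q (g k) ≤ ε) : q (∑ k ∈ Finset.range N, (c : ℂ) • g k) ≤ N * (c * ε) := by
  calc q (∑ k ∈ Finset.range N, (c : ℂ) • g k)
      ≤ ∑ k ∈ Finset.range N, q ((c : ℂ) • g k) :=
        Finset.le_sum_of_subadditive q (map_zero q).le (map_add_le_add q) _ _
    _ ≤ ∑ k ∈ Finset.range N, c * ε := by
        refine Finset.sum_le_sum fun k hk => ?_
        rw [map_smul_eq_mul, Complex.norm_real, Real.norm_of_nonneg hc]
        exact mul_le_mul_of_nonneg_left (hg k (Finset.mem_range.1 hk)) hc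
    _ = N * (c * ε) := by simp

theorem riemannSum_const (z : X) (h : ℝ) {N : ℕ} (hN : N ≠ 0) :
    riemannSum (fun _ => z) h N = (h : ℂ) • z := by
  have : (N : ℂ) ≠ 0 := Nat.cast_ne_zero.2 hN
  rw [riemannSum, ← Finset.sum_smul, Finset.sum_const, Finset.card_range, nsmul_eq_mul]
  push_cast
  rw [mul_div_cancel₀ _ this]

theorem seminorm_riemannSum_sub_le (q : Seminorm ℂ X) (f : ℝ → X) {h ε : ℝ} (hh : 0 ≤ h)
    {N : ℕ} (hN : N ≠ 0) (z : X) (hz : ∀ s ∈ Set.Icc 0 h, q (f s - z) ≤ ε) :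
    q (riemannSum f h N - (h : ℂ) • z) ≤ h * ε := by
  have hN' : (0 : ℝ) < N := by positivity
  rw [← riemannSum_const z h hN, riemannSum, riemannSum, ← Finset.sum_sub_distrib]
  simp only [← smul_sub]
  refine (seminorm_sum_smul_le q (by positivity) N _ fun k hk => hz _ ⟨by positivity, ?_⟩).trans
    (le_of_eq (by field_simp))
  rw [div_le_iff₀ hN']
  have : (k : ℝ) ≤ N := by exact_mod_cast hk.le
  exact mul_le_mul_of_nonneg_left this hh

/-- Each coarse node is repeated `M` times and compared with the fine nodes of its cell, all within
`h / N` of it. -/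
theorem seminorm_riemannSum_sub_refinement_le (q : Seminorm ℂ X) (f : ℝ → X) {h ε : ℝ}
    (hh : 0 ≤ h) {N M : ℕ} (hN : N ≠ 0) (hM : M ≠ 0)
    (hf : ∀ s ∈ Set.Icc 0 h, ∀ s' ∈ Set.Icc 0 h, |s - s'| ≤ h / N → q (f s - f s') ≤ ε) :
    q (riemannSum f h N - riemannSum f h (N * M)) ≤ h * ε := by
  have hN' : (0 : ℝ) < N := by positivity
  have hM' : (0 : ℝ) < M := by positivity
  -- The outer factor `1` lets `seminorm_sum_smul_le` apply to both nested sums.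
  have key : riemannSum f h N - riemannSum f h (N * M) =
      ∑ k ∈ Finset.range N, ((1 : ℝ) : ℂ) • ∑ i ∈ Finset.range M, ((h / (N * M) : ℝ) : ℂ) •
        (f (h * k / N) - f (h * (k * M + i : ℕ) / (N * M : ℕ))) := by
    rw [riemannSum, riemannSum, sum_range_mul_eq, ← Finset.sum_sub_distrib]
    refine Finset.sum_congr rfl fun k _ => ?_
    simp only [smul_sub, Finset.sum_sub_distrib, Complex.ofReal_one, one_smul]
    congr 1
    · rw [Finset.sum_const, Finset.card_range, ← Nat.cast_smul_eq_nsmul ℂ, smul_smul]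
      congr 1
      have : (M : ℂ) ≠ 0 := Nat.cast_ne_zero.2 hM
      have : (N : ℂ) ≠ 0 := Nat.cast_ne_zero.2 hN
      push_cast
      field_simp
    · simp
  rw [key]
  refine (seminorm_sum_smul_le q zero_le_one N _ fun k hk =>
    seminorm_sum_smul_le q (ε := ε) (by positivity) M _ fun i hi => ?_).trans
    (le_of_eq (by field_simp))
  have hkN : (k : ℝ) + 1 ≤ N := by exact_mod_cast hk
  have hiM : (i : ℝ) ≤ M := by exact_mod_cast hi.le
  have e1 : h * (k * M + i : ℕ) / (N * M : ℕ) = h * k / N + h / N * (i / M) := by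
    push_cast
    field_simp
  have hi1 : (i : ℝ) / M ≤ 1 := (div_le_one hM').2 hiM
  have hi2 : h / N * (i / M) ≤ h / N := mul_le_of_le_one_right (by positivity) hi1
  have e2 : h * k / N + h / N ≤ h := by
    rw [← add_div, div_le_iff₀ hN']
    nlinarith
  have e3 : 0 ≤ h / N * (i / M) := by positivity
  refine hf _ ⟨by positivity, ?_⟩ _ ⟨by positivity, ?_⟩ ?_
  · linarith [show (0 : ℝ) ≤ h / N by positivity]
  · rw [e1]; linarith
  · rw [e1, sub_add_cancel_left, abs_neg, abs_of_nonneg e3]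
    exact hi2

theorem map_riemannSum [TopologicalSpace X] (φ : X →L[ℂ] ℂ) (f : ℝ → X) (h : ℝ) (N : ℕ) :
    φ (riemannSum f h N) = riemannSum (fun s => φ (f s)) h N := by
  simp only [riemannSum, map_sum, map_smul]

end Riemann

section Uniform

variable {X : Type*} [AddCommGroup X] [Module ℂ X] [UniformSpace X] [IsUniformAddGroup X]

theorem exists_mesh (f : ℝ → X) (hf : Continuous f) (q : Seminorm ℂ X) (hq : Continuous q) (h : ℝ)
    {ε : ℝ} (hε : 0 < ε) :
    ∃ N₀ : ℕ, ∀ N : ℕ, N₀ ≤ N → ∀ s ∈ Set.Icc 0 h, ∀ s' ∈ Set.Icc 0 h, |s - s'| ≤ h / N →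
      q (f s - f s') ≤ ε := by
  have hu := isCompact_Icc.uniformContinuousOn_of_continuous (s := Set.Icc 0 h) hf.continuousOn
  have hV : {p : X × X | q (p.2 - p.1) < ε} ∈ uniformity X := by
    rw [uniformity_eq_comap_nhds_zero]
    refine ⟨{x | q x < ε}, ?_, fun p hp => hp⟩
    exact (isOpen_lt hq continuous_const).mem_nhds (by simpa using hε)
  have h1 := hu hV
  obtain ⟨δ, hδ, hd⟩ := (Metric.uniformity_basis_dist.inf_principal _).mem_iff.1 h1
  obtain ⟨N₀, hN₀⟩ := exists_nat_gt (h / δ)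
  refine ⟨N₀, fun N hN s hs s' hs' hss => ?_⟩
  have : (s', s) ∈ {p : ℝ × ℝ | dist p.1 p.2 < δ} ∩ Set.Icc 0 h ×ˢ Set.Icc 0 h := by
    refine ⟨?_, hs', hs⟩
    rw [Set.mem_ofPred_eq, dist_comm, Real.dist_eq]
    have hNN : (N₀ : ℝ) ≤ N := by exact_mod_cast hN
    have h0 : 0 ≤ h := hs.1.trans hs.2
    have hNpos : (0 : ℝ) < N := lt_of_le_of_lt (by positivity) (hN₀.trans_le hNN)
    refine hss.trans_lt ?_
    rw [div_lt_iff₀ hNpos]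
    have := (div_lt_iff₀ hδ).1 (hN₀.trans_le hNN)
    linarith
  exact le_of_lt (hd this)

theorem tendsto_riemannSum_complex (g : ℝ → ℂ) (hg : Continuous g) {h : ℝ} (hh : 0 ≤ h) :
    Tendsto (fun n : ℕ => riemannSum g h (n + 1)) atTop (𝓝 (∫ s in (0 : ℝ)..h, g s)) := by
  rw [Metric.tendsto_atTop]
  intro ε hε
  have hε' : 0 < ε / (h + 1) := by positivity
  obtain ⟨N₀, hN₀⟩ := exists_mesh g hg (normSeminorm ℂ ℂ) continuous_norm h hε'
  refine ⟨N₀, fun n hn => ?_⟩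
  set N := n + 1 with hNdef
  have hN' : (0 : ℝ) < N := by positivity
  have hm := hN₀ N (by omega)
  have hsum := intervalIntegral.sum_integral_adjacent_intervals (f := g) (μ := MeasureTheory.volume)
    (a := fun k : ℕ => h * k / N) (n := N) fun k _ => hg.intervalIntegrable _ _
  have e1 : h * (N : ℝ) / N = h := by field_simp
  simp only [Nat.cast_zero, mul_zero, zero_div, e1] at hsum
  rw [← hsum, dist_eq_norm, riemannSum, ← Finset.sum_sub_distrib]
  have hle : ∀ k ∈ Finset.range N, ‖((h / N : ℝ) : ℂ) • g (h * k / N) -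
      ∫ x in (h * k / N)..(h * (k + 1 : ℕ) / N), g x‖ ≤ ε / (h + 1) * (h / N) := by
    intro k hk
    have hkN : (k : ℝ) + 1 ≤ N := by exact_mod_cast Finset.mem_range.1 hk
    have e2 : h * (k + 1 : ℕ) / N = h * k / N + h / N := by push_cast; ring
    have e3 : h * k / N + h / N ≤ h := by
      rw [← add_div, div_le_iff₀ hN']
      nlinarith
    have hpos : 0 ≤ h / N := by positivity
    have e4 : ((h / N : ℝ) : ℂ) • g (h * k / N) =
        ∫ x in (h * k / N)..(h * (k + 1 : ℕ) / N), g (h * k / N) := by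
      rw [intervalIntegral.integral_const, e2, add_sub_cancel_left, Complex.coe_smul]
    rw [e4, ← intervalIntegral.integral_sub (by simp) (hg.intervalIntegrable _ _)]
    refine (intervalIntegral.norm_integral_le_of_norm_le_const (C := ε / (h + 1)) ?_).trans ?_
    · intro x hx
      rw [e2, Set.uIoc_of_le (by linarith)] at hx
      have h0 : 0 ≤ h * k / N := by positivity
      refine hm _ ⟨h0, by linarith⟩ _ ⟨by linarith [hx.1], by linarith [hx.2]⟩ ?_
      rw [abs_sub_comm, abs_of_nonneg (by linarith [hx.1])]
      linarith [hx.2]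
    · rw [e2, add_sub_cancel_left, abs_of_nonneg hpos]
  calc _ ≤ ∑ k ∈ Finset.range N, ε / (h + 1) * (h / N) := norm_sum_le_of_le _ hle
    _ = ε * (h / (h + 1)) := by
      rw [Finset.sum_const, Finset.card_range, nsmul_eq_mul]
      field_simp
    _ < ε * 1 := by
      refine mul_lt_mul_of_pos_left ?_ hε
      rw [div_lt_one (by positivity)]
      linarith
    _ = ε := mul_one ε

variable [ContinuousSMul ℂ X] [LocallyConvexSpace ℝ X]

theorem cauchySeq_riemannSum (f : ℝ → X) (hf : Continuous f) {h : ℝ} (hh : 0 ≤ h) :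
    CauchySeq fun n : ℕ => riemannSum f h (n + 1) := by
  rw [cauchySeq_iff]
  intro V hV
  rw [uniformity_eq_comap_nhds_zero] at hV
  obtain ⟨U, hU, hUV⟩ := hV
  obtain ⟨q, hq, hqU⟩ := exists_continuous_seminorm_ball_subset hU
  have hε : 0 < 1 / (2 * h + 1) := by positivity
  obtain ⟨N₀, hN₀⟩ := exists_mesh f hf q hq h hε
  refine ⟨N₀, fun k hk l hl => hUV (hqU _ ?_)⟩
  -- Both sums are compared with their common refinement into `(k + 1) * (l + 1)` pieces.
  have h1 := seminorm_riemannSum_sub_refinement_le q f hh k.succ_ne_zero l.succ_ne_zero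
    (hN₀ (k + 1) (by omega))
  have h2 := seminorm_riemannSum_sub_refinement_le q f hh l.succ_ne_zero k.succ_ne_zero
    (hN₀ (l + 1) (by omega))
  rw [mul_comm (l + 1)] at h2
  have h3 := map_sub_le_add q
    (riemannSum f h (l + 1) - riemannSum f h ((k + 1) * (l + 1)))
    (riemannSum f h (k + 1) - riemannSum f h ((k + 1) * (l + 1)))
  rw [sub_sub_sub_cancel_right] at h3
  refine (h3.trans (add_le_add h2 h1)).trans_lt ?_
  rw [← two_mul, ← mul_assoc, mul_one_div, div_lt_one (by positivity)]
  linarith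

/-- The integral of a continuous function over `[0, h]` in a sequentially complete locally convex
space, with its weak characterization and the estimate by continuous seminorms. -/
theorem exists_integral (hX : SeqCompleteSpace X) (f : ℝ → X) (hf : Continuous f) {h : ℝ}
    (hh : 0 ≤ h) :
    ∃ y : X, (∀ φ : X →L[ℂ] ℂ, φ y = ∫ s in (0 : ℝ)..h, φ (f s)) ∧
      ∀ q : Seminorm ℂ X, Continuous q → ∀ (z : X) (ε : ℝ),
        (∀ s ∈ Set.Icc 0 h, q (f s - z) ≤ ε) → q (y - (h : ℂ) • z) ≤ h * ε := by
  obtain ⟨y, hy⟩ := hX _ (cauchySeq_riemannSum f hf hh)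
  refine ⟨y, fun φ => ?_, fun q hq z ε hz => ?_⟩
  · refine tendsto_nhds_unique ((φ.continuous.tendsto y).comp hy) ?_
    simp only [Function.comp_def, map_riemannSum]
    exact tendsto_riemannSum_complex _ (φ.continuous.comp hf) hh
  · refine le_of_tendsto ((hq.tendsto _).comp (hy.sub_const _)) (Eventually.of_forall fun n => ?_)
    exact seminorm_riemannSum_sub_le q f hh n.succ_ne_zero z hz

end Uniform
-- Orbits and their right derivatives
section Orbit

variable {X : Type*} [AddCommGroup X] [Module ℂ X] [TopologicalSpace X]

/-- The orbit `s ↦ T(s) x`, extended to negative times by the constant value `T(0) x`. -/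
noncomputable def orbit (T : ℝ≥0 → X →L[ℂ] X) (x : X) (s : ℝ) : X :=
  T s.toNNReal x

variable {T : ℝ≥0 → X →L[ℂ] X}

theorem orbit_coe (x : X) (t : ℝ≥0) : orbit T x t = T t x := by
  rw [orbit, Real.toNNReal_coe]

theorem IsSemigroup.orbit_zero (hT : IsSemigroup T) (x : X) : orbit T x 0 = x := by
  simp [orbit, hT.zero]

theorem StronglyContinuous.continuous_orbit (hcont : StronglyContinuous T) (x : X) :
    Continuous (orbit T x) :=
  (hcont x).comp continuous_real_toNNReal

theorem IsSemigroup.orbit_add (hT : IsSemigroup T) (x : X) (t : ℝ≥0) {s : ℝ} (hs : 0 ≤ s) :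
    orbit T x (t + s) = T t (orbit T x s) := by
  rw [orbit, orbit, Real.toNNReal_add t.coe_nonneg hs, Real.toNNReal_coe, hT.add]
  rfl

/-- For `r > s` the difference quotient is `T(s)` applied to that of `x` at `0`, and `T(s)` is
continuous. Only the right derivative comes out of this argument. -/
theorem IsSemigroup.hasDerivWithinAt_orbit (hT : IsSemigroup T) (φ : X →L[ℂ] ℂ) {x y : X}
    (hxy : HasRightDeriv T x y) {s : ℝ} (hs : 0 ≤ s) :
    HasDerivWithinAt (fun s => φ (orbit T x s)) (φ (orbit T y s)) (Set.Ioi s) s := by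
  rw [hasDerivWithinAt_iff_tendsto_slope' Set.self_notMem_Ioi]
  have h1 : Tendsto (fun r : ℝ => (r - s).toNNReal) (𝓝[>] s) (𝓝[>] 0) := by
    refine tendsto_nhdsWithin_iff.2 ⟨?_, ?_⟩
    · have : Continuous fun r : ℝ => (r - s).toNNReal := by fun_prop
      simpa using (this.tendsto s).mono_left nhdsWithin_le_nhds
    · filter_upwards [self_mem_nhdsWithin] with r hr
      exact Real.toNNReal_pos.2 (sub_pos.2 hr)
  have h2 := ((φ.comp (T s.toNNReal)).continuous.tendsto y).comp (hxy.comp h1)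
  refine h2.congr' ?_
  filter_upwards [self_mem_nhdsWithin] with r hr
  have hrs : 0 ≤ r - s := (sub_pos.2 hr).le
  have h3 : orbit T x r = T s.toNNReal (T (r - s).toNNReal x) := by
    have := hT.orbit_add x s.toNNReal hrs
    rw [Real.coe_toNNReal _ hs, add_sub_cancel] at this
    exact this
  simp only [Function.comp_apply, ContinuousLinearMap.comp_apply, slope_def_module, h3,
    Real.coe_toNNReal _ hrs, map_smul, map_sub]
  rw [← Complex.ofReal_inv, Complex.coe_smul]
  rfl

end Orbit

/-! ### Integrated orbits, and eigenfunctionals from generator to semigroup -/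

section Integral

variable {X : Type*} [AddCommGroup X] [Module ℂ X] [UniformSpace X] [IsUniformAddGroup X]
  [ContinuousSMul ℂ X] [LocallyConvexSpace ℝ X] [T2Space X] {T : ℝ≥0 → X →L[ℂ] X}

/-- `∫₀ʰ T(s) x ds` lies in the domain of the generator, which maps it to `T(h) x - x`. -/
theorem IsSemigroup.exists_integral_orbit (hT : IsSemigroup T) (hcont : StronglyContinuous T)
    (hX : SeqCompleteSpace X) (x : X) (h : ℝ≥0) :
    ∃ y : X, HasRightDeriv T y (T h x - x) ∧
      ∀ φ : X →L[ℂ] ℂ, φ y = ∫ s in (0 : ℝ)..h, φ (orbit T x s) := by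
  have ho := hcont.continuous_orbit x
  obtain ⟨y, hy, -⟩ := exists_integral hX (orbit T x) ho h.coe_nonneg
  refine ⟨y, ?_, hy⟩
  set f : ℝ → X := fun s => orbit T x (h + s) - orbit T x s with hfdef
  have hf : Continuous f := by fun_prop
  have hf0 : f 0 = T h x - x := by simp [f, hT.orbit_zero, orbit_coe]
  choose K hK hKq using fun t : ℝ≥0 => exists_integral hX f hf t.coe_nonneg
  -- Here `K t = ∫₀ᵗ f`. Tested on functionals, this is `∫_t^{t+h} - ∫_0^h = ∫_h^{h+t} - ∫_0^t`;
  -- afterwards `K t / t → f 0 = T(h)x - x`.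
  have hTK : ∀ t : ℝ≥0, T t y - y = K t := by
    intro t
    refine eq_of_forall_functional_eq fun φ => ?_
    have hg : Continuous fun s => φ (orbit T x s) := φ.continuous.comp ho
    have hi : ∀ a b : ℝ, IntervalIntegrable (fun s => φ (orbit T x s)) MeasureTheory.volume a b :=
      fun a b => hg.intervalIntegrable a b
    have e1 : φ (T t y) = ∫ s in (t : ℝ)..(t + h), φ (orbit T x s) := by
      have := hy (φ.comp (T t))
      rw [ContinuousLinearMap.comp_apply] at this
      rw [this]
      have e := intervalIntegral.integral_comp_add_left (a := 0) (b := h)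
        (fun s => φ (orbit T x s)) (t : ℝ)
      rw [add_zero] at e
      rw [← e]
      refine intervalIntegral.integral_congr fun s hs => ?_
      rw [Set.uIcc_of_le h.coe_nonneg] at hs
      simp only [hT.orbit_add x t hs.1, ContinuousLinearMap.comp_apply]
    have e2 : φ (K t) = (∫ s in (h : ℝ)..(h + t), φ (orbit T x s)) -
        ∫ s in (0 : ℝ)..t, φ (orbit T x s) := by
      have e := intervalIntegral.integral_comp_add_left (a := 0) (b := t)
        (fun s => φ (orbit T x s)) (h : ℝ)
      rw [add_zero] at e
      have hi' : IntervalIntegrable (fun s => φ (orbit T x (h + s))) MeasureTheory.volume 0 t :=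
        (hg.comp (continuous_const_add (h : ℝ))).intervalIntegrable _ _
      rw [hK t φ, ← e, ← intervalIntegral.integral_sub hi' (hi _ _)]
      simp only [hfdef, map_sub]
    have a1 := intervalIntegral.integral_add_adjacent_intervals (hi 0 t) (hi t (t + h))
    have a2 := intervalIntegral.integral_add_adjacent_intervals (hi 0 h) (hi h (h + t))
    have e3 := hy φ
    rw [map_sub, e1, e2, e3]
    rw [add_comm (h : ℝ) t] at a2 ⊢
    linear_combination a1 - a2
  refine tendsto_of_forall_seminorm fun q hq ε hε => ?_
  have hev : ∀ᶠ s in 𝓝 (0 : ℝ), q (f s - (T h x - x)) < ε := by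
    have hc : Continuous fun s => q (f s - (T h x - x)) := by fun_prop
    refine (hc.tendsto 0).eventually (gt_mem_nhds ?_)
    simpa [hf0] using hε
  obtain ⟨δ, hδ, hd⟩ := Metric.eventually_nhds_iff.1 hev
  have hlt : ∀ᶠ t : ℝ≥0 in 𝓝[>] 0, (t : ℝ) < δ := by
    have : Tendsto (fun t : ℝ≥0 => (t : ℝ)) (𝓝[>] 0) (𝓝 0) :=
      (NNReal.continuous_coe.tendsto' 0 0 rfl).mono_left nhdsWithin_le_nhds
    exact this.eventually (gt_mem_nhds hδ)
  filter_upwards [hlt, self_mem_nhdsWithin] with t ht ht0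
  have ht0' : (0 : ℝ) < t := NNReal.coe_pos.2 ht0
  have hne : ((t : ℝ) : ℂ) ≠ 0 := Complex.ofReal_ne_zero.2 ht0'.ne'
  have hb := hKq t q hq (T h x - x) ε fun s hs => (hd (by
    rw [Real.dist_eq, sub_zero, abs_of_nonneg hs.1]; exact hs.2.trans_lt ht)).le
  have e : ((t : ℝ) : ℂ)⁻¹ • (T t y - y) - (T h x - x) =
      ((t : ℝ) : ℂ)⁻¹ • (K t - ((t : ℝ) : ℂ) • (T h x - x)) := by
    rw [hTK, smul_sub, smul_smul, inv_mul_cancel₀ hne, one_smul]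
  rw [e, map_smul_eq_mul, norm_inv, Complex.norm_real, Real.norm_of_nonneg ht0'.le,
    inv_mul_le_iff₀ ht0']
  exact hb

theorem eq_exp_mul_of_eq_integral {g : ℝ → ℂ} (hg : Continuous g) (z : ℂ)
    (h : ∀ s, 0 ≤ s → g s - g 0 = z * ∫ r in (0 : ℝ)..s, g r) {t : ℝ} (ht : 0 ≤ t) :
    g t = Complex.exp (t * z) * g 0 := by
  -- `k` is differentiable everywhere and equals `g` on `s ≥ 0`, where alone the integral equation
  -- holds; there `e^{-sz} k(s)` has zero derivative.
  set k : ℝ → ℂ := fun s => g 0 + z * ∫ r in (0 : ℝ)..s, g r with hk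
  have hkg : ∀ s, 0 ≤ s → k s = g s := fun s hs => by rw [hk]; linear_combination -(h s hs)
  have hd : ∀ s : ℝ, HasDerivAt (fun s : ℝ => Complex.exp (-(s * z)) * k s)
      (Complex.exp (-(s * z)) * -(1 * z) * k s + Complex.exp (-(s * z)) * (z * g s)) s := by
    intro s
    have h1 : HasDerivAt (fun s : ℝ => Complex.exp (-(s * z)))
        (Complex.exp (-(s * z)) * -(1 * z)) s :=
      ((Complex.ofRealCLM.hasDerivAt (x := s)).mul_const z).neg.cexp
    exact h1.mul (((hg.integral_hasStrictDerivAt 0 s).hasDerivAt.const_mul z).const_add (g 0))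
  have hconst := constant_of_has_deriv_right_zero (a := 0) (b := t)
    (f := fun s : ℝ => Complex.exp (-(s * z)) * k s)
    (fun s _ => (hd s).continuousAt.continuousWithinAt)
    (fun s hs => by
      have := (hd s).hasDerivWithinAt (s := Set.Ici s)
      rw [hkg s hs.1] at this
      convert! this using 1
      ring) t ⟨ht, le_rfl⟩
  simp only [hkg t ht, hkg 0 le_rfl, Complex.ofReal_zero, zero_mul, neg_zero, Complex.exp_zero,
    one_mul] at hconst
  rw [← hconst, ← mul_assoc, ← Complex.exp_add, add_neg_cancel, Complex.exp_zero, one_mul]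

/-- The hypothesis is applied to `∫₀ˢ T(r)x dr`, which is in the domain for every `x`, so no density
of the domain is needed. -/
theorem IsSemigroup.functional_apply_of_generator (hT : IsSemigroup T)
    (hcont : StronglyContinuous T) (hX : SeqCompleteSpace X) {φ : X →L[ℂ] ℂ} {z : ℂ}
    (hφ : ∀ x : (generator T).domain, φ (generator T x) = z * φ x) (t : ℝ≥0) (x : X) :
    φ (T t x) = Complex.exp ((t : ℝ) * z) * φ x := by
  have h := eq_exp_mul_of_eq_integral (g := fun s => φ (orbit T x s))
    (φ.continuous.comp (hcont.continuous_orbit x)) z (fun s hs => ?_) t.coe_nonneg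
  · simpa only [orbit_coe, hT.orbit_zero] using h
  · lift s to ℝ≥0 using hs
    obtain ⟨y, hy, hyφ⟩ := hT.exists_integral_orbit hcont hX x s
    have h1 := hφ ⟨y, _, hy⟩
    rw [(hasRightDeriv_generator T ⟨y, _, hy⟩).unique hy] at h1
    simp only [orbit_coe, hT.orbit_zero, ← map_sub]
    rw [h1, hyφ]

end Integral
-- Fourier coefficients, and eigenfunctionals from semigroup to generator
/-- A continuous function on `[0, t]` with equal boundary values all of whose Fourier coefficients
vanish is zero on `[0, t)`. -/
theorem eq_zero_of_fourier_integral_eq_zero {g : ℝ → ℂ} (hg : Continuous g) {t : ℝ} (ht : 0 < t)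
    (hper : g 0 = g t)
    (h : ∀ n : ℤ, ∫ s in (0 : ℝ)..t, Complex.exp (-(s * (2 * Real.pi * Complex.I * n / t))) * g s
      = 0) {s : ℝ} (hs : s ∈ Set.Ico 0 t) : g s = 0 := by
  have : Fact (0 < t) := ⟨ht⟩
  let F : C(AddCircle t, ℂ) :=
    ⟨AddCircle.liftIco t 0 g, AddCircle.liftIco_zero_continuous hper hg.continuousOn⟩
  have hF : ∀ n : ℤ, fourierCoeff F n = 0 := by
    intro n
    have e : fourierCoeff F n = fourierCoeff (AddCircle.liftIco t 0 g) n := rfl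
    rw [e, fourierCoeff_liftIco_eq, fourierCoeffOn_eq_integral]
    have : ∫ x in (0 : ℝ)..(0 + t), fourier (-n) (x : AddCircle (0 + t - 0)) • g x = 0 := by
      rw [← h n, zero_add]
      refine intervalIntegral.integral_congr fun x _ => ?_
      simp only [fourier_coe_apply, smul_eq_mul]
      congr 2
      push_cast
      simp only [sub_zero]
      ring
    rw [this, smul_zero]
  have hF' : fourierCoeff F = 0 := funext hF
  -- Zero coefficients are summable, so the Fourier series converges pointwise to `F`, and its sum
  -- is `0`.
  have hsum := has_pointwise_sum_fourier_series_of_summable (f := F) (by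
    rw [hF']; exact summable_zero) (s : AddCircle t)
  simp only [hF, zero_smul] at hsum
  have h0 := hasSum_zero.unique hsum
  have e : F (s : AddCircle t) = g s := AddCircle.liftIco_zero_coe_apply hs
  rw [← e, ← h0]

section Functional

variable {X : Type*} [AddCommGroup X] [Module ℂ X] [TopologicalSpace X]
  [IsTopologicalAddGroup X] {T : ℝ≥0 → X →L[ℂ] X}

/-- The functional `x ↦ ∫₀ᵗ e^{-sz} φ(T(s) x) ds` is linear and continuous. -/
theorem exists_laplace_functional (hcont : StronglyContinuous T) (hequi : LocallyEquicontinuous T)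
    (φ : X →L[ℂ] ℂ) (z : ℂ) (t : ℝ≥0) :
    ∃ ψ : X →L[ℂ] ℂ, ∀ x, ψ x = ∫ s in (0 : ℝ)..t, Complex.exp (-(s * z)) * φ (orbit T x s) := by
  have hexp : Continuous fun s : ℝ => Complex.exp (-(s * z)) := by fun_prop
  have hi : ∀ x, IntervalIntegrable (fun s : ℝ => Complex.exp (-(s * z)) * φ (orbit T x s))
      MeasureTheory.volume 0 t := fun x =>
    (hexp.mul (φ.continuous.comp (hcont.continuous_orbit x))).intervalIntegrable _ _
  let ψ : X →ₗ[ℂ] ℂ :=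
    { toFun := fun x => ∫ s in (0 : ℝ)..t, Complex.exp (-(s * z)) * φ (orbit T x s)
      map_add' := fun x y => by
        rw [← intervalIntegral.integral_add (hi x) (hi y)]
        simp only [orbit, map_add, mul_add]
      map_smul' := fun c x => by
        rw [RingHom.id_apply, smul_eq_mul, ← intervalIntegral.integral_const_mul]
        simp only [orbit, map_smul, smul_eq_mul, mul_left_comm] }
  -- Equicontinuity for the seminorm `‖φ ·‖` bounds the orbit term on `[0, t]` uniformly by `C * p
  -- x`.
  obtain ⟨p, hp, C, hC, hpC⟩ := hequi ((normSeminorm ℂ ℂ).comp (φ : X →ₗ[ℂ] ℂ))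
    (continuous_norm.comp φ.continuous) t
  obtain ⟨M, hM⟩ := (isCompact_Icc (a := (0 : ℝ)) (b := t)).exists_bound_of_continuousOn
    hexp.continuousOn
  have hM0 : 0 ≤ M := (norm_nonneg _).trans (hM 0 ⟨le_rfl, t.coe_nonneg⟩)
  have hbound : ∀ x, ‖ψ x‖ ≤ M * (C * p x) * t := by
    intro x
    have := intervalIntegral.norm_integral_le_of_norm_le_const (a := 0) (b := t)
      (f := fun s : ℝ => Complex.exp (-(s * z)) * φ (orbit T x s)) (C := M * (C * p x)) ?_
    · rwa [sub_zero, abs_of_nonneg t.coe_nonneg] at this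
    · intro s hs
      rw [Set.uIoc_of_le t.coe_nonneg] at hs
      rw [norm_mul]
      exact mul_le_mul (hM s ⟨hs.1.le, hs.2⟩) (hpC _ (Real.toNNReal_le_iff_le_coe.2 hs.2) x)
        (norm_nonneg _) hM0
  refine ⟨⟨ψ, continuous_of_continuousAt_zero ψ ?_⟩, fun _ => rfl⟩
  rw [ContinuousAt, map_zero]
  refine squeeze_zero_norm hbound ?_
  have hc : Continuous fun x => M * (C * p x) * t := by fun_prop
  simpa using hc.tendsto 0

variable [ContinuousSMul ℂ X] [T2Space X]

/-- Integrate the right derivative of `e^{-sz} φ(T(s)x)` over `[0, t]`: the boundary terms cancel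
because `φ ∘ T(t) = e^{tz} φ`. -/
theorem IsSemigroup.laplace_functional_generator (hT : IsSemigroup T)
    (hcont : StronglyContinuous T) {φ ψ : X →L[ℂ] ℂ} {z : ℂ} {t : ℝ≥0}
    (hφ : ∀ x, φ (T t x) = Complex.exp ((t : ℝ) * z) * φ x)
    (hψ : ∀ x, ψ x = ∫ s in (0 : ℝ)..t, Complex.exp (-(s * z)) * φ (orbit T x s))
    (x : (generator T).domain) : ψ (generator T x) = z * ψ x := by
  set y := generator T x
  have hxy : HasRightDeriv T x y := hasRightDeriv_generator T x
  have hexp : Continuous fun s : ℝ => Complex.exp (-(s * z)) := by fun_prop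
  have hc : ∀ x : X, Continuous fun s : ℝ => Complex.exp (-(s * z)) * φ (orbit T x s) := fun x =>
    hexp.mul (φ.continuous.comp (hcont.continuous_orbit x))
  have hcz : Continuous fun s : ℝ => z * (Complex.exp (-(s * z)) * φ (orbit T x s)) :=
    continuous_const.mul (hc x)
  have hftc := intervalIntegral.integral_eq_sub_of_hasDeriv_right (a := 0) (b := t)
    (f := fun s : ℝ => Complex.exp (-(s * z)) * φ (orbit T x s))
    (f' := fun s : ℝ => Complex.exp (-(s * z)) * φ (orbit T y s) -
      z * (Complex.exp (-(s * z)) * φ (orbit T x s)))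
    (hc x).continuousOn
    (fun s hs => by
      have hs0 : 0 ≤ s := by
        rw [min_eq_left t.coe_nonneg] at hs
        exact hs.1.le
      have h1 : HasDerivAt (fun s : ℝ => Complex.exp (-(s * z)))
          (Complex.exp (-(s * z)) * -(1 * z)) s :=
        ((Complex.ofRealCLM.hasDerivAt (x := s)).mul_const z).neg.cexp
      convert! h1.hasDerivWithinAt.mul (hT.hasDerivWithinAt_orbit φ hxy hs0) using 1
      ring)
    (((hc y).sub hcz).intervalIntegrable _ _)
  rw [intervalIntegral.integral_sub ((hc y).intervalIntegrable _ _)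
    (hcz.intervalIntegrable _ _), intervalIntegral.integral_const_mul,
    ← hψ, ← hψ, orbit_coe, hφ, hT.orbit_zero, ← mul_assoc, ← Complex.exp_add] at hftc
  simpa [sub_eq_zero] using hftc

theorem IsSemigroup.exists_eigenfunctional_generator (hT : IsSemigroup T)
    (hcont : StronglyContinuous T) (hequi : LocallyEquicontinuous T) {t : ℝ≥0} (ht : 0 < t)
    {w : ℂ} (hw : w ≠ 0) {φ : X →L[ℂ] ℂ} (hφ0 : φ ≠ 0) (hφ : ∀ x, φ (T t x) = w * φ x) :
    ∃ z : ℂ, Complex.exp ((t : ℝ) * z) = w ∧ ∃ ψ : X →L[ℂ] ℂ, ψ ≠ 0 ∧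
      ∀ x : (generator T).domain, ψ (generator T x) = z * ψ x := by
  have ht' : (0 : ℝ) < t := NNReal.coe_pos.2 ht
  have htC : ((t : ℝ) : ℂ) ≠ 0 := Complex.ofReal_ne_zero.2 ht'.ne'
  -- These are the solutions of `e^{tz} = w`.
  let z : ℤ → ℂ := fun n => Complex.log w / (t : ℝ) + 2 * Real.pi * Complex.I * n / (t : ℝ)
  have hz : ∀ n, Complex.exp ((t : ℝ) * z n) = w := by
    intro n
    have e : ((t : ℝ) : ℂ) * z n = Complex.log w + n * (2 * Real.pi * Complex.I) := by
      simp only [z]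
      field_simp
    rw [e, Complex.exp_add, Complex.exp_int_mul_two_pi_mul_I, mul_one, Complex.exp_log hw]
  choose ψ hψ using fun n => exists_laplace_functional hcont hequi φ (z n) t
  by_contra hcon
  push Not at hcon
  have hψ0 : ∀ n, ψ n = 0 := by
    intro n
    by_contra hne
    obtain ⟨x, hx⟩ := hcon (z n) (hz n) (ψ n) hne
    exact hx (hT.laplace_functional_generator hcont (fun x => by rw [hz, hφ]) (hψ n) x)
  refine hφ0 (ContinuousLinearMap.ext fun x => ?_)
  -- Multiplying `g` by `e^{-2πins/t}` gives the integrand of `ψ n x`; the factor `e^{-log w}` at `s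
  -- = t` cancels `w`, so `g 0 = g t`.
  set g : ℝ → ℂ := fun s => Complex.exp (-(s * (Complex.log w / (t : ℝ)))) * φ (orbit T x s)
  have hg : Continuous g := by
    have := φ.continuous.comp (hcont.continuous_orbit x)
    have hexp : Continuous fun s : ℝ => Complex.exp (-(s * (Complex.log w / (t : ℝ)))) := by
      fun_prop
    exact hexp.mul this
  have hg0 : g 0 = φ x := by simp [g, hT.orbit_zero]
  have hgt : g t = φ x := by
    simp only [g, orbit_coe, hφ]
    rw [mul_div_cancel₀ _ htC, Complex.exp_neg, Complex.exp_log hw, inv_mul_cancel_left₀ hw]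
  have h := eq_zero_of_fourier_integral_eq_zero hg ht' (hg0.trans hgt.symm) (fun n => ?_)
    ⟨le_rfl, ht'⟩
  · rw [← hg0, h]
    rfl
  · have h0 : ψ n x = 0 := by rw [hψ0 n]; rfl
    rw [← h0, hψ n x]
    refine intervalIntegral.integral_congr fun s _ => ?_
    simp only [g, z]
    rw [← mul_assoc, ← Complex.exp_add]
    congr 2
    ring

end Functional
end LCSemigroup

theorem mainTheorem2 {X : Type*} [AddCommGroup X] [Module ℂ X] [UniformSpace X]
    [IsUniformAddGroup X] [ContinuousSMul ℂ X] [LocallyConvexSpace ℝ X] [T2Space X]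
    (hX : LCSemigroup.SeqCompleteSpace X)
    -- `StrongDual ℂ X` carries the topology of uniform convergence on bounded subsets of `X`
    (hX' : LCSemigroup.SeqCompleteSpace (StrongDual ℂ X))
    (T : ℝ≥0 → X →L[ℂ] X) (hT : LCSemigroup.IsSemigroup T)
    (hcont : LCSemigroup.StronglyContinuous T)
    (hequi : LCSemigroup.LocallyEquicontinuous T)
    (hres : (LCSemigroup.algResolventSet (LCSemigroup.generator T)).Nonempty) :
    ∀ t : ℝ≥0,
      (0 < t ∨ (LCSemigroup.residualSpectrum (LCSemigroup.generator T)).Nonempty ∨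
        Subsingleton X) →
      LCSemigroup.residualSpectrum (LCSemigroup.toOperator (T t)) \ {0} =
        (fun μ : ℂ => Complex.exp (((t : ℝ) : ℂ) * μ)) ''
          LCSemigroup.residualSpectrum (LCSemigroup.generator T) := by
  intro t ht
  ext w
  simp only [Set.mem_sdiff, Set.mem_singleton_iff, Set.mem_image,
    LCSemigroup.mem_residualSpectrum_iff (LCSemigroup.generator T),
    LCSemigroup.mem_residualSpectrum_toOperator_iff]
  constructor
  · rintro ⟨⟨φ, hφ0, hφ⟩, hw⟩
    rcases t.coe_nonneg.eq_or_lt with h0 | hpos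
    · obtain rfl : t = 0 := NNReal.coe_eq_zero.1 h0.symm
      obtain ⟨x, hx⟩ : ∃ x, φ x ≠ 0 := by
        by_contra hcon
        push Not at hcon
        exact hφ0 (ContinuousLinearMap.ext hcon)
      have hw1 : w = 1 := by
        have h1 := hφ x
        rw [hT.zero, ContinuousLinearMap.id_apply] at h1
        exact (mul_right_cancel₀ hx ((one_mul _).trans h1)).symm
      -- At `t = 0` only `w = 1` occurs, and any `z` in the residual spectrum of the generator maps
      -- to it.
      rcases ht with ht | ⟨z, hz⟩ | hsub
      · exact absurd ht (lt_irrefl _)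
      · refine ⟨z, (LCSemigroup.mem_residualSpectrum_iff _ z).1 hz, ?_⟩
        simp [hw1]
      · exact absurd (by rw [Subsingleton.elim x 0, map_zero]) hx
    · obtain ⟨z, hz, ψ, hψ0, hψ⟩ :=
        hT.exists_eigenfunctional_generator hcont hequi (NNReal.coe_pos.1 hpos) hw hφ0 hφ
      exact ⟨z, ⟨ψ, hψ0, hψ⟩, hz⟩
  · rintro ⟨z, ⟨φ, hφ0, hφ⟩, rfl⟩
    exact ⟨⟨φ, hφ0, hT.functional_apply_of_generator hcont hX hφ t⟩, Complex.exp_ne_zero _⟩
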